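/- Let $\mathbf{X}$ be a set, $\mathbf{L}$ a real Hilbert space, $\mathbf{Y}\subset\mathbf{L}$ a non-empty set with compact closure, and $\mathbf{F}:=\overline{\mathrm{co}}\,\mathbf{Y}$ its closed convex hull. In each round $n=1,2,\dots$ Reality announces a datum $x_n\in\mathbf{X}$, then Forecaster announces $f_n\in\mathbf{F}$, then Reality announces an observation $y_n\in\mathbf{Y}$; all moves are seen by both players. Let $\mathcal{F}$ be a real reproducing kernel Hilbert space (RKHS) on $\mathbf{F}\times\mathbf{X}$, i.e. a Hilbert space of functions $F:\mathbf{F}\times\mathbf{X}\to\mathbb{R}$ whose evaluation functionals are continuous. Let $\mathbf{K}_z\in\mathcal{F}$ be the representer of evaluation at $z$, so that $F(z)=\langle \mathbf{K}_z,F\rangle_{\mathcal{F}}$ for all $F\in\mathcal{F}$, and let $\mathbf{K}(z,z'):=\langle \mathbf{K}_z,\mathbf{K}_{z'}\rangle_{\mathcal{F}}$ be its kernel. Suppose that $\mathbf{K}$ is admissible, i.e. $\mathbf{K}((f,x),(f',x'))$ is continuous in $f$ for all fixed $x,f',x'$, and that $\mathbf{C}_{\mathcal{F}}:=\sup_{z\in\mathbf{F}\times\mathbf{X}}\|\mathbf{K}_z\|_{\mathcal{F}}<\infty$.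 A K29 strategy with parameter $\mathbf{K}$ is a strategy for Forecaster that, in round $n$, whatever the previous moves and the datum $x_n$, outputs a point $f_n\in\mathbf{F}$ with $S(f_n)=0$, where $$S(f):=\sum_{i=1}^{n-1}\mathbf{K}((f_i,x_i),(f,x_n))\,(y_i-f_i),\qquad f\in\mathbf{F},$$ or, if $S$ has no zero in $\mathbf{F}$, a point $f_n\in\partial\mathbf{F}$ at which $S(f_n)$ is normal and directed exteriorly to $\mathbf{F}$, i.e. $\langle S(f_n),g-f_n\rangle_{\mathbf{L}}\le 0$ for all $g\in\mathbf{F}$. Then a K29 strategy with parameter $\mathbf{K}$ exists, and every such strategy ensures, whatever Reality's moves, that $$\Bigl\|\sum_{i=1}^{n}F(f_i,x_i)\,(y_i-f_i)\Bigr\|_{\mathbf{L}}\le \operatorname{diam}(\mathbf{Y})\,\mathbf{C}_{\mathcal{F}}\,\|F\|_{\mathcal{F}}\,\sqrt{n}$$ for all $n$ and all $F\in\mathcal{F}$, where $\operatorname{diam}(\mathbf{Y}):=\sup_{y,y'\in\mathbf{Y}}\|y-y'\|_{\mathbf{L}}$. -/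

import Mathlib

noncomputable section

namespace DefensiveForecasting

/-- Forecaster's move space: the closed convex hull of the observation space `Y`. -/
abbrev ForecastSpace {L : Type*} [NormedAddCommGroup L] [InnerProductSpace ℝ L] (Y : Set L) :
    Type _ :=
  ↥(closedConvexHull ℝ Y)

/-- What has been announced in `n` finished rounds: datum, forecast and observation of each. -/
abbrev History (X : Type*) {L : Type*} [NormedAddCommGroup L] [InnerProductSpace ℝ L]
    (Y : Set L) (n : ℕ) : Type _ :=
  Fin n → X × ForecastSpace Y × Y

/-- A strategy for Forecaster: from the finished rounds and the newly announced datum it produces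
the next forecast. -/
abbrev Strategy (X : Type*) {L : Type*} [NormedAddCommGroup L] [InnerProductSpace ℝ L]
    (Y : Set L) : Type _ :=
  (n : ℕ) → History X Y n → X → ForecastSpace Y

/-- The forecasts announced when Forecaster follows `σ` and Reality announces the data
`x 0, x 1, …` and the observations `y 0, y 1, …` (rounds are numbered from `0`). -/
def forecasts {X L : Type*} [NormedAddCommGroup L] [InnerProductSpace ℝ L] {Y : Set L}
    (σ : Strategy X Y) (x : ℕ → X) (y : ℕ → Y) (n : ℕ) : ForecastSpace Y :=
  σ n (fun i : Fin n => (x i, forecasts σ x y i, y i)) (x n)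
termination_by n
decreasing_by exact i.isLt

/-- A kernel on `F × X` is admissible if `k ((f, x), (f', x'))` is continuous in `f`. -/
def IsAdmissible {X L : Type*} [NormedAddCommGroup L] [InnerProductSpace ℝ L] {Y : Set L}
    (k : ForecastSpace Y × X → ForecastSpace Y × X → ℝ) : Prop :=
  ∀ (x : X) (z : ForecastSpace Y × X), Continuous fun f : ForecastSpace Y => k (f, x) z

/-- The vector field `S f = ∑ i, k ((fᵢ, xᵢ), (f, x)) (yᵢ - fᵢ)`, the sum being over the finished
rounds and `x` being the current datum. -/
def vectorField {X L : Type*} [NormedAddCommGroup L] [InnerProductSpace ℝ L] {Y : Set L}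
    (k : ForecastSpace Y × X → ForecastSpace Y × X → ℝ) {n : ℕ} (h : History X Y n) (x : X)
    (f : ForecastSpace Y) : L :=
  ∑ i, k ((h i).2.1, (h i).1) (f, x) • (((h i).2.2 : L) - ((h i).2.1 : L))

/-- The vector `v` is normal and directed exteriorly to `F` at `f`. -/
def IsExteriorNormal {L : Type*} [NormedAddCommGroup L] [InnerProductSpace ℝ L]
    (F : Set L) (f v : L) : Prop :=
  ∀ g ∈ F, inner ℝ v (g - f) ≤ 0

/-- The forecast rule of the K29 strategy: `f` is a zero of the vector field, or, if there is no
zero, a boundary point at which the vector field is normal and directed exteriorly. -/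
def IsK29Forecast {X L : Type*} [NormedAddCommGroup L] [InnerProductSpace ℝ L] {Y : Set L}
    (k : ForecastSpace Y × X → ForecastSpace Y × X → ℝ) {n : ℕ} (h : History X Y n) (x : X)
    (f : ForecastSpace Y) : Prop :=
  vectorField k h x f = 0 ∨
    ((¬ ∃ g : ForecastSpace Y, vectorField k h x g = 0) ∧
      (f : L) ∈ frontier (closedConvexHull ℝ Y) ∧
      IsExteriorNormal (closedConvexHull ℝ Y) (f : L) (vectorField k h x f))

/-- `σ` is a K29 strategy with parameter `k`: all its forecasts obey the K29 rule. -/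
def IsK29Strategy {X L : Type*} [NormedAddCommGroup L] [InnerProductSpace ℝ L] {Y : Set L}
    (k : ForecastSpace Y × X → ForecastSpace Y × X → ℝ) (σ : Strategy X Y) : Prop :=
  ∀ (n : ℕ) (h : History X Y n) (x : X), IsK29Forecast k h x (σ n h x)

/-- The representer `K_z` of the evaluation functional at `z` in a real RKHS on `Z`. -/
def representer {Z : Type*} (H : Type*) [NormedAddCommGroup H] [InnerProductSpace ℝ H]
    [CompleteSpace H] [RKHS ℝ H Z ℝ] (z : Z) : H :=
  RKHS.kerFun H z (1 : ℝ)

theorem inner_representer {Z H : Type*} [NormedAddCommGroup H] [InnerProductSpace ℝ H]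
    [CompleteSpace H] [RKHS ℝ H Z ℝ] (z : Z) (F : H) : inner ℝ (representer H z) F = F z := by
  simp [representer]

/-- The kernel `k (z, z') = ⟪K_z, K_z'⟫` of a real RKHS on `Z`. -/
def rkhsKernel {Z : Type*} (H : Type*) [NormedAddCommGroup H] [InnerProductSpace ℝ H]
    [CompleteSpace H] [RKHS ℝ H Z ℝ] (z z' : Z) : ℝ :=
  inner ℝ (representer H z) (representer H z')

/-- The supremum over `z` of the norms of the representers `K_z` (meaningful if they are
bounded). -/
def rkhsConst {Z : Type*} (H : Type*) [NormedAddCommGroup H] [InnerProductSpace ℝ H]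
    [CompleteSpace H] [RKHS ℝ H Z ℝ] : ℝ :=
  ⨆ z : Z, ‖representer H z‖

end DefensiveForecasting

end

/-!
A K29 forecast is a solution `f` of the variational inequality `⟪S f, g - f⟫ ≤ 0` for all `g` in the
closed convex hull of `Y`: a zero of `S` is one, and a solution that is not a zero of `S` lies on
the boundary.

*Existence.* The closed convex hull of a relatively compact set in a Hilbert space is compact, and a
continuous vector field on a compact convex set satisfies a variational inequality there
(`Convex.exists_isExteriorNormal`). By compactness only finitely many `g` matter at a time, which
leaves a problem on a simplex, solved by Sperner's covering lemma
(`stdSimplex.exists_mem_forall_mem`) applied to Nash's map. The covering lemma itself is derived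
from Scarf's combinatorial lemma (`exists_colourful_dominant`), which replaces the triangulation of the
simplex by the dominant subsets of an arbitrary finite net, and is proved by the usual parity count
of facets.

*The bound.* In the tensor product of the RKHS and `L` put
`T n = ∑ i < n, K_{(fᵢ, xᵢ)} ⊗ (yᵢ - fᵢ)`. The inner product of `T n` with the next summand is
`⟪S fₙ, yₙ - fₙ⟫ ≤ 0`, and that summand has norm at most `C * diam Y`, so
`‖T n‖² ≤ n * (C * diam Y)²` by induction. Finally `u = ∑ i < n, F (fᵢ, xᵢ) • (yᵢ - fᵢ)` satisfies
`‖u‖² = ⟪T n, F ⊗ u⟫ ≤ ‖T n‖ * ‖F‖ * ‖u‖`.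
-/

/-! ### Scarf's combinatorial lemma -/

section Dominant

variable {V I α : Type*} [LinearOrder α]

/-- Let a linear order on `V` be given for each `i : I`, encoded by an injective `r i : V → α`. A
finite set `τ` is dominant if no point of `V` lies above the minimum of `τ` in all these orders.
The dominant sets play the part of the simplices of a triangulation, those of size `card I` being
the top-dimensional ones. -/
def IsDominant (r : I → V → α) (τ : Finset V) : Prop :=
  ∀ y, ∃ i, ∀ v ∈ τ, r i y ≤ r i v

/-- Every element of a dominant set is its minimum in one of the orders. -/
theorem IsDominant.exists_eq {r : I → V → α} (hr : ∀ i, Function.Injective (r i)) {τ : Finset V}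
    (hτ : IsDominant r τ) {m : I → V} (hmτ : ∀ i, m i ∈ τ) (hm : ∀ i, ∀ v ∈ τ, r i (m i) ≤ r i v)
    {v : V} (hv : v ∈ τ) : ∃ i, m i = v := by
  obtain ⟨i, hi⟩ := hτ v
  exact ⟨i, hr i (le_antisymm (hm i v hv) (hi _ (hmτ i)))⟩

variable [Fintype V] [DecidableEq V] [Fintype I]

/-- A dominant set `τ` that is one element short of full size extends in exactly two ways to a
dominant set of full size, provided that `τ` does not lie on the boundary (hypothesis `hint`).
Indeed the map sending `i` to the `i`-minimum of `τ` identifies exactly one pair `a ≠ b`. The new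
point must be the unique minimum for `a` or for `b`; if for `a`, it has to be the `a`-largest of
the points that lie above the minimum of `τ` in all orders but the `a`-th one. -/
theorem IsDominant.exists_pair_of_insert {r : I → V → α} (hr : ∀ i, Function.Injective (r i))
    {τ : Finset V} (hτ : IsDominant r τ) (hne : τ.Nonempty)
    (hcard : τ.card + 1 = Fintype.card I)
    (hint : ∀ a, ∃ y, ∀ i, i ≠ a → ∃ v ∈ τ, r i v < r i y) :
    ∃ y z, y ≠ z ∧ ∀ x, (x ∉ τ ∧ IsDominant r (insert x τ)) ↔ (x = y ∨ x = z) := by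
  classical
  choose m hmτ hm using fun i => τ.exists_min_image (r i) hne
  have hsurj : ∀ v ∈ τ, ∃ i, m i = v := fun v hv => hτ.exists_eq hr hmτ hm hv
  obtain ⟨a, -, b, -, hab, hmab⟩ := Finset.exists_ne_map_eq_of_card_lt_of_maps_to
    (s := (Finset.univ : Finset I)) (t := τ) (by rw [Finset.card_univ]; omega) (f := m)
    (fun i _ => hmτ i)
  -- the points above the minimum of `τ` in all orders but the `k`-th one, and the largest of them
  let M : I → Finset V := fun k => Finset.univ.filter fun y => ∀ i, i ≠ k → r i (m i) < r i y
  have hM : ∀ k y, y ∈ M k ↔ ∀ i, i ≠ k → r i (m i) < r i y := by simp [M]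
  have hMne : ∀ k, (M k).Nonempty := by
    intro k
    obtain ⟨y, hy⟩ := hint k
    refine ⟨y, (hM k y).2 fun i hi => ?_⟩
    obtain ⟨v, hv, hlt⟩ := hy i hi
    exact (hm i v hv).trans_lt hlt
  choose t htM ht using fun k => (M k).exists_max_image (r k) (hMne k)
  have hle : ∀ k y, y ∈ M k → ∀ v ∈ τ, r k y ≤ r k v := by
    intro k y hy v hv
    obtain ⟨i, hi⟩ := hτ y
    obtain rfl : i = k := by
      by_contra hik
      exact absurd ((hM k y).1 hy i hik) (not_lt.2 (hi _ (hmτ i)))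
    exact hi v hv
  have hins : ∀ k l, k ≠ l → m k = m l → t k ∉ τ ∧ IsDominant r (insert (t k) τ) := by
    intro k l hkl hmkl
    constructor
    · intro hk
      obtain ⟨j, hj⟩ := hsurj _ hk
      have hjk : j = k := by
        by_contra hjk
        have := (hM k _).1 (htM k) j hjk
        rw [hj] at this
        exact lt_irrefl _ this
      subst hjk
      have := (hM j _).1 (htM j) l hkl.symm
      rw [← hj, hmkl] at this
      exact lt_irrefl _ this
    · intro z
      by_cases hz : z ∈ M k
      · refine ⟨k, fun v hv => ?_⟩
        rcases Finset.mem_insert.1 hv with rfl | hv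
        · exact ht k z hz
        · exact hle k z hz v hv
      · rw [hM] at hz
        push Not at hz
        obtain ⟨i, hik, hi⟩ := hz
        refine ⟨i, fun v hv => ?_⟩
        rcases Finset.mem_insert.1 hv with rfl | hv
        · exact hi.trans ((hM k _).1 (htM k) i hik).le
        · exact hi.trans (hm i v hv)
  refine ⟨t a, t b, ?_, fun x => ⟨?_, ?_⟩⟩
  · intro h
    obtain ⟨i, hi⟩ := hτ (t a)
    by_cases hia : i = a
    · have hib : i ≠ b := by rintro rfl; exact hab hia.symm
      have := (hM b _).1 (htM b) i hib
      rw [← h] at this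
      exact absurd (hi _ (hmτ i)) (not_le.2 this)
    · exact absurd (hi _ (hmτ i)) (not_le.2 ((hM a _).1 (htM a) i hia))
  · rintro ⟨hxτ, hx⟩
    -- `n i` is the `i`-minimum of `insert x τ`; by counting, `n` is injective
    choose n hnτ hn using fun i =>
      (insert x τ).exists_min_image (r i) (Finset.insert_nonempty x τ)
    have hninj : Function.Injective n := by
      have himg : Finset.univ.image n = insert x τ := by
        ext v
        simp only [Finset.mem_image, Finset.mem_univ, true_and]
        constructor
        · rintro ⟨i, rfl⟩
          exact hnτ i
        · exact fun hv => hx.exists_eq hr hnτ hn hv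
      rw [← Set.injOn_univ, ← Finset.coe_univ, ← Finset.card_image_iff, himg,
        Finset.card_insert_of_notMem hxτ, hcard, Finset.card_univ]
    obtain ⟨k, hk⟩ := hx.exists_eq hr hnτ hn (Finset.mem_insert_self x τ)
    have hnm : ∀ i, i ≠ k → n i = m i := by
      intro i hik
      have hne : n i ≠ x := fun h => hik (hninj (h.trans hk.symm))
      have h1 : n i ∈ τ := (Finset.mem_insert.1 (hnτ i)).resolve_left hne
      exact hr i (le_antisymm (hn i _ (Finset.mem_insert_of_mem (hmτ i))) (hm i _ h1))
    have hxM : x ∈ M k := by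
      refine (hM k x).2 fun i hik => ?_
      refine lt_of_le_of_ne ?_ ?_
      · rw [← hnm i hik]
        exact hn i x (Finset.mem_insert_self x τ)
      · intro h
        exact hxτ (hr i h ▸ hmτ i)
    have hxt : x = t k := by
      refine hr k (le_antisymm (ht k x hxM) ?_)
      obtain ⟨i, hi⟩ := hx (t k)
      obtain rfl : i = k := by
        by_contra hik
        exact absurd ((hM k _).1 (htM k) i hik)
          (not_lt.2 (hi _ (Finset.mem_insert_of_mem (hmτ i))))
      exact hi x (Finset.mem_insert_self x τ)
    by_cases hka : k = a
    · exact Or.inl (hka ▸ hxt)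
    by_cases hkb : k = b
    · exact Or.inr (hkb ▸ hxt)
    · have : n a = n b := by rw [hnm a (Ne.symm hka), hnm b (Ne.symm hkb), hmab]
      exact absurd (hninj this) hab
  · rintro (rfl | rfl)
    · exact hins a b hab hmab
    · exact hins b a hab.symm hmab.symm

end Dominant

section Colouring

variable {V I : Type*} [DecidableEq V] [Fintype I] [DecidableEq I]

/-- The facets of a set `ρ` that carry all colours but `i₀` come in pairs if `ρ` does not carry all
colours. -/
theorem even_card_facets (c : V → I) (i₀ : I) {ρ : Finset V} (hρ : ρ.card = Fintype.card I)
    (hc : ρ.image c ≠ Finset.univ) :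
    Even (ρ.powerset.filter fun τ => τ.card + 1 = Fintype.card I ∧
      τ.image c = Finset.univ.erase i₀).card := by
  set D := ρ.powerset.filter fun τ => τ.card + 1 = Fintype.card I ∧
      τ.image c = Finset.univ.erase i₀ with hD
  have key : ∀ x, ρ.erase x ∈ D ↔ x ∈ ρ ∧ (ρ.erase x).image c = Finset.univ.erase i₀ := by
    intro x
    simp only [hD, Finset.mem_filter, Finset.mem_powerset, Finset.erase_subset, true_and]
    constructor
    · rintro ⟨h1, h2⟩
      refine ⟨?_, h2⟩
      by_contra hx
      rw [Finset.erase_eq_of_notMem hx] at h1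
      omega
    · rintro ⟨h1, h2⟩
      exact ⟨by rw [Finset.card_erase_add_one h1, hρ], h2⟩
  have hform : ∀ τ ∈ D, ∃ x ∈ ρ, τ = ρ.erase x := by
    intro τ hτ
    simp only [hD, Finset.mem_filter, Finset.mem_powerset] at hτ
    obtain ⟨hsub, hcd, -⟩ := hτ
    have : (ρ \ τ).card = 1 := by rw [Finset.card_sdiff_of_subset hsub]; omega
    obtain ⟨x, hx⟩ := Finset.card_eq_one.1 this
    have hxρ : x ∈ ρ \ τ := by simp [hx]
    refine ⟨x, (Finset.mem_sdiff.1 hxρ).1, ?_⟩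
    rw [Finset.erase_eq, ← hx, Finset.sdiff_sdiff_eq_self hsub]
  rcases D.eq_empty_or_nonempty with hE | ⟨τ, hτ⟩
  · rw [hE]; simp
  obtain ⟨x, hxρ, rfl⟩ := hform τ hτ
  have himg := ((key x).1 hτ).2
  have hinj : Set.InjOn c (ρ.erase x : Finset V) := by
    refine Finset.card_image_iff.1 ?_
    rw [himg, Finset.card_erase_of_mem (Finset.mem_univ _), Finset.card_erase_of_mem hxρ, hρ,
      Finset.card_univ]
  have hcx : c x ≠ i₀ := by
    intro h
    apply hc
    rw [← Finset.insert_erase hxρ, Finset.image_insert, himg, h,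
      Finset.insert_erase (Finset.mem_univ _)]
  obtain ⟨x', hx', hcx'⟩ : ∃ x' ∈ ρ.erase x, c x' = c x := by
    rw [← Finset.mem_image, himg]
    simp [hcx]
  have hxx' : x' ≠ x := (Finset.mem_erase.1 hx').1
  have hx'ρ : x' ∈ ρ := (Finset.mem_erase.1 hx').2
  have hDeq : D = {ρ.erase x, ρ.erase x'} := by
    ext τ
    simp only [Finset.mem_insert, Finset.mem_singleton]
    constructor
    · intro hτ'
      obtain ⟨w, hwρ, rfl⟩ := hform τ hτ'
      by_contra hcon
      push Not at hcon
      have hwx : w ≠ x := fun h => hcon.1 (by rw [h])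
      have hwx' : w ≠ x' := fun h => hcon.2 (by rw [h])
      -- `x` and `x'` have the same colour, so the colours of `ρ.erase w` are not distinct
      have hinj' : Set.InjOn c (ρ.erase w : Finset V) := by
        refine Finset.card_image_iff.1 ?_
        rw [((key w).1 hτ').2, Finset.card_erase_of_mem (Finset.mem_univ _),
          Finset.card_erase_of_mem hwρ, hρ, Finset.card_univ]
      exact hxx' (hinj' (by simp [hwx'.symm, hx'ρ]) (by simp [hwx.symm, hxρ]) hcx')
    · rintro (rfl | rfl)
      · exact hτ
      · refine (key x').2 ⟨hx'ρ, ?_⟩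
        have hx'2 : x ∈ ρ.erase x' := Finset.mem_erase.2 ⟨hxx'.symm, hxρ⟩
        rw [← himg, ← Finset.insert_erase hx'2, ← Finset.insert_erase hx', Finset.image_insert,
          Finset.image_insert, hcx', Finset.erase_right_comm]
  rw [hDeq, Finset.card_pair]
  · exact even_two
  · intro h
    have : x ∈ ρ.erase x' := Finset.mem_erase.2 ⟨hxx'.symm, hxρ⟩
    rw [← h] at this
    simp at this

end Colouring

/-- **Scarf's lemma**, for finitely many preorders on a finite set `X`, given by functions
`w i : X → ℝ`, and a colouring `c` of `X`. -/
theorem exists_colourful_dominant {X I : Type*} [Finite X] [Nonempty X] [Finite I] [Nonempty I]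
    (w : I → X → ℝ) (c : X → I) :
    ∃ (σ : Finset X) (C : Finset I), (∀ i ∈ C, ∃ x ∈ σ, c x = i) ∧
      ∀ y, ∃ i ∈ C, ∀ x ∈ σ, w i y ≤ w i x := by
  classical
  have := Fintype.ofFinite X
  have := Fintype.ofFinite I
  -- Adjoin a vertex for each colour: a pair `(σ, C)` becomes the set `σ ∪ Cᶜ` in `X ⊕ I`.
  let V := X ⊕ I
  let e : V ≃ Fin (Fintype.card V) := Fintype.equivFin V
  let w' : I → V → EReal := fun i => Sum.elim (fun x => (w i x : EReal)) fun j =>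
    if j = i then ⊥ else ⊤
  -- the second component breaks ties
  let r : I → V → EReal ×ₗ Fin (Fintype.card V) := fun i v => toLex (w' i v, e v)
  have hr : ∀ i, Function.Injective (r i) := by
    intro i v v' h
    have h' : (w' i v, e v) = (w' i v', e v') := toLex.injective h
    exact e.injective (Prod.ext_iff.1 h').2
  have hlt : ∀ i v v', w' i v < w' i v' → r i v < r i v' := fun i v v' h =>
    Prod.Lex.toLex_lt_toLex.2 (Or.inl h)
  have hle : ∀ i v v', r i v ≤ r i v' → w' i v ≤ w' i v' := fun i v v' h =>
    (Prod.Lex.toLex_le_toLex.1 h).elim le_of_lt fun h => h.1.le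
  have hbot : ∀ i x, r i (.inr i) < r i (.inl x) := fun i x => hlt i _ _ (by simp [w'])
  have htop : ∀ i j x, i ≠ j → r i (.inl x) < r i (.inr j) := fun i j x h =>
    hlt i _ _ (by simp [w', h.symm, EReal.coe_lt_top])
  have hbot' : ∀ i v, r i (.inr i) ≤ r i v := by
    rintro i (x | j)
    · exact (hbot i x).le
    · by_cases h : j = i
      · rw [h]
      · exact (hlt i _ _ (by simp [w', h])).le
  let c' : V → I := Sum.elim c id
  obtain ⟨i₀⟩ := ‹Nonempty I›
  let R : Finset (Finset V) := Finset.univ.filter fun ρ =>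
    ρ.card = Fintype.card I ∧ IsDominant r ρ
  let D : Finset (Finset V) := Finset.univ.filter fun τ =>
    (τ.card + 1 = Fintype.card I ∧ τ.image c' = Finset.univ.erase i₀) ∧ IsDominant r τ
  have hanti : ∀ τ ρ : Finset V, τ ⊆ ρ → IsDominant r ρ → IsDominant r τ := by
    intro τ ρ h hρ y
    obtain ⟨i, hi⟩ := hρ y
    exact ⟨i, fun v hv => hi v (h hv)⟩
  -- It suffices to find a dominant set of full size that carries all colours.
  suffices h : ∃ ρ ∈ R, ρ.image c' = Finset.univ by
    obtain ⟨ρ, hρR, hρc⟩ := h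
    obtain ⟨-, -, hdom⟩ := Finset.mem_filter.1 hρR
    refine ⟨Finset.univ.filter fun x => Sum.inl x ∈ ρ, Finset.univ.filter fun i => Sum.inr i ∉ ρ,
      ?_, ?_⟩
    · intro i hi
      have hi' : Sum.inr i ∉ ρ := by simpa using hi
      have : i ∈ ρ.image c' := by simp [hρc]
      obtain ⟨v, hv, hvi⟩ := Finset.mem_image.1 this
      rcases v with x | j
      · exact ⟨x, by simpa using hv, hvi⟩
      · obtain rfl : j = i := hvi
        exact absurd hv hi'
    · intro y
      obtain ⟨i, hi⟩ := hdom (.inl y)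
      refine ⟨i, ?_, fun x hx => ?_⟩
      · simp only [Finset.mem_filter, Finset.mem_univ, true_and]
        exact fun h => absurd (hbot i y) (not_lt.2 (hi _ h))
      · have := hle i _ _ (hi (.inl x) (by simpa using hx))
        exact EReal.coe_le_coe_iff.1 this
  by_contra hno
  push Not at hno
  -- Count the incidences between `D` and `R` modulo two: without a set carrying all colours every
  -- member of `R` has an even number of them, while in `D` only the boundary facet has an odd one.
  have hdc := Finset.sum_card_bipartiteAbove_eq_sum_card_bipartiteBelow
    (s := D) (t := R) (fun τ ρ => τ ⊆ ρ)
  have hR : ∀ ρ ∈ R, Even (D.bipartiteBelow (fun τ ρ => τ ⊆ ρ) ρ).card := by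
    intro ρ hρ
    obtain ⟨-, hcard, hdom⟩ := Finset.mem_filter.1 hρ
    convert even_card_facets c' i₀ hcard (hno ρ hρ) using 2
    ext τ
    simp only [Finset.mem_bipartiteBelow, D, Finset.mem_filter, Finset.mem_univ, true_and,
      Finset.mem_powerset]
    constructor
    · rintro ⟨⟨h1, -⟩, h2⟩
      exact ⟨h2, h1⟩
    · rintro ⟨h1, h2⟩
      exact ⟨⟨h2, hanti τ ρ h1 hdom⟩, h1⟩
  have hext : ∀ τ : Finset V, τ.card + 1 = Fintype.card I → ∀ ρ,
      ρ ∈ R.filter (fun ρ => τ ⊆ ρ) ↔ ∃ x, (x ∉ τ ∧ IsDominant r (insert x τ)) ∧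
        ρ = insert x τ := by
    intro τ hτ ρ
    simp only [R, Finset.mem_filter, Finset.mem_univ, true_and]
    constructor
    · rintro ⟨⟨h1, h2⟩, h3⟩
      have : (ρ \ τ).card = 1 := by rw [Finset.card_sdiff_of_subset h3]; omega
      obtain ⟨x, hx⟩ := Finset.card_eq_one.1 this
      have hxρ : x ∈ ρ \ τ := by simp [hx]
      have hρ : ρ = insert x τ := by
        rw [Finset.insert_eq, ← hx, Finset.sdiff_union_of_subset h3]
      exact ⟨x, ⟨(Finset.mem_sdiff.1 hxρ).2, hρ ▸ h2⟩, hρ⟩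
    · rintro ⟨x, ⟨h1, h2⟩, rfl⟩
      exact ⟨⟨by rw [Finset.card_insert_of_notMem h1, hτ], h2⟩, Finset.subset_insert _ _⟩
  have hins : ∀ (τ : Finset V) (x y : V), x ∉ τ → insert x τ = insert y τ → x = y := by
    intro τ x y hx h
    have : x ∈ insert y τ := h ▸ Finset.mem_insert_self x τ
    exact (Finset.mem_insert.1 this).resolve_right hx
  -- the only element of `D` on the boundary
  let τ₀ : Finset V := (Finset.univ.erase i₀).image Sum.inr
  have hτ₀mem : ∀ j, Sum.inr j ∈ τ₀ ↔ j ≠ i₀ := by simp [τ₀]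
  have hτ₀inl : ∀ x, Sum.inl x ∉ τ₀ := by simp [τ₀]
  have hτ₀card : τ₀.card + 1 = Fintype.card I := by
    rw [Finset.card_image_of_injective _ Sum.inr_injective,
      Finset.card_erase_add_one (Finset.mem_univ _), Finset.card_univ]
  obtain ⟨t, -, ht⟩ := (Finset.univ : Finset X).exists_max_image (fun x => r i₀ (.inl x))
    Finset.univ_nonempty
  have ht₀ : IsDominant r (insert (.inl t) τ₀) := by
    rintro (x | j)
    · refine ⟨i₀, fun v hv => ?_⟩
      rcases Finset.mem_insert.1 hv with rfl | hv
      · exact ht x (Finset.mem_univ x)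
      · rcases v with x' | j
        · exact absurd hv (hτ₀inl x')
        · exact (htop i₀ j x ((hτ₀mem j).1 hv).symm).le
    · exact ⟨j, fun v _ => hbot' j v⟩
  have hτ₀D : τ₀ ∈ D := by
    simp only [D, Finset.mem_filter, Finset.mem_univ, true_and]
    refine ⟨⟨hτ₀card, ?_⟩, hanti _ _ (Finset.subset_insert _ _) ht₀⟩
    ext j
    simp [τ₀, c', Finset.mem_image]
  have hone : (D.erase τ₀).sum (fun τ => (R.bipartiteAbove (fun τ ρ => τ ⊆ ρ) τ).card) +
      (R.bipartiteAbove (fun τ ρ => τ ⊆ ρ) τ₀).card =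
      ∑ τ ∈ D, (R.bipartiteAbove (fun τ ρ => τ ⊆ ρ) τ).card := Finset.sum_erase_add _ _ hτ₀D
  have h1 : (R.bipartiteAbove (fun τ ρ => τ ⊆ ρ) τ₀).card = 1 := by
    rw [Finset.card_eq_one]
    refine ⟨insert (.inl t) τ₀, ?_⟩
    ext ρ
    rw [Finset.bipartiteAbove, hext τ₀ hτ₀card, Finset.mem_singleton]
    constructor
    · rintro ⟨y, ⟨hyτ, hy⟩, rfl⟩
      rcases y with y | j
      · congr 1
        obtain ⟨i, hi⟩ := hy (.inl t)
        have hi₀ : i = i₀ := by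
          by_contra hne
          exact absurd (hbot i t) (not_lt.2 (hi _ (Finset.mem_insert_of_mem ((hτ₀mem i).2 hne))))
        subst hi₀
        exact hr i (le_antisymm (ht y (Finset.mem_univ y)) (hi _ (Finset.mem_insert_self _ _)))
      · -- a set that contains a vertex `inr i` for each colour `i` is not dominant
        exfalso
        obtain ⟨i, hi⟩ := hy (.inl t)
        refine absurd (hbot i t) (not_lt.2 (hi _ ?_))
        by_cases hii : i = i₀
        · have hj : j = i₀ := by
            by_contra hj
            exact hyτ ((hτ₀mem j).2 hj)
          rw [hii, hj]
          exact Finset.mem_insert_self _ _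
        · exact Finset.mem_insert_of_mem ((hτ₀mem i).2 hii)
    · rintro rfl
      exact ⟨.inl t, ⟨hτ₀inl t, ht₀⟩, rfl⟩
  have h2 : ∀ τ ∈ D.erase τ₀, Even (R.bipartiteAbove (fun τ ρ => τ ⊆ ρ) τ).card := by
    intro τ hτ
    obtain ⟨hne, hτD⟩ := Finset.mem_erase.1 hτ
    obtain ⟨-, ⟨hcard, himg⟩, hdom⟩ := Finset.mem_filter.1 hτD
    obtain ⟨x, hx⟩ : ∃ x, Sum.inl x ∈ τ := by
      by_contra hcon
      push Not at hcon
      apply hne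
      refine Finset.eq_of_subset_of_card_le ?_ (by omega)
      rintro (x | j) hv
      · exact absurd hv (hcon x)
      · rw [hτ₀mem]
        have : c' (.inr j) ∈ τ.image c' := Finset.mem_image_of_mem c' hv
        rw [himg] at this
        exact (Finset.mem_erase.1 this).1
    obtain ⟨y, z, hyz, hiff⟩ := hdom.exists_pair_of_insert hr ⟨_, hx⟩ hcard
      fun a => ⟨.inr a, fun i hi => ⟨_, hx, htop i a x hi⟩⟩
    have : R.bipartiteAbove (fun τ ρ => τ ⊆ ρ) τ = {insert y τ, insert z τ} := by
      ext ρ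
      rw [Finset.bipartiteAbove, hext τ hcard, Finset.mem_insert, Finset.mem_singleton]
      simp only [hiff]
      constructor
      · rintro ⟨_, rfl | rfl, rfl⟩
        · exact Or.inl rfl
        · exact Or.inr rfl
      · rintro (rfl | rfl)
        · exact ⟨y, Or.inl rfl, rfl⟩
        · exact ⟨z, Or.inr rfl, rfl⟩
    rw [this, Finset.card_pair fun h => hyz (hins τ y z ((hiff y).2 (Or.inl rfl)).1 h)]
    exact even_two
  have hodd : ¬ Even (∑ τ ∈ D, (R.bipartiteAbove (fun τ ρ => τ ⊆ ρ) τ).card) := by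
    rw [← hone, h1, Nat.even_add_one, not_not]
    exact Finset.even_sum _ h2
  exact hodd (hdc ▸ Finset.even_sum _ hR)

/-! ### Closed coverings of a simplex -/

/-- The vertices of a dominant set of a `δ`-net are close to each other, and their coordinates
outside `C` are small. -/
theorem stdSimplex.small_of_dominant {I : Type*} [Fintype I] {δ : ℝ}
    {X : Finset (I → ℝ)} (hX : ∀ x ∈ X, x ∈ stdSimplex ℝ I)
    (hnet : ∀ z ∈ stdSimplex ℝ I, ∃ x ∈ X, dist z x < δ) {σ : Finset (I → ℝ)} (hσX : σ ⊆ X)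
    (hσ : σ.Nonempty) {C : Finset I} (hC : C.Nonempty)
    (hdom : ∀ y ∈ X, ∃ i ∈ C, ∀ x ∈ σ, y i ≤ x i) :
    (∀ x ∈ σ, ∀ p ∈ σ, dist x p ≤ Fintype.card I * δ) ∧
      ∀ p ∈ σ, ∀ i ∉ C, p i ≤ Fintype.card I * δ := by
  classical
  have hσΔ : ∀ x ∈ σ, x ∈ stdSimplex ℝ I := fun x hx => hX x (hσX hx)
  obtain ⟨p₀, hp₀⟩ := hσ
  have hδ : 0 < δ := by
    obtain ⟨x, -, hx⟩ := hnet p₀ (hσΔ p₀ hp₀)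
    exact dist_nonneg.trans_lt hx
  -- the vector of the coordinate minima of `σ`, cut off outside `C`
  let m : I → ℝ := fun i => if i ∈ C then σ.inf' ⟨p₀, hp₀⟩ (fun x => x i) else 0
  have hmle : ∀ x ∈ σ, ∀ i, m i ≤ x i := by
    intro x hx i
    by_cases hi : i ∈ C
    · simp only [m, hi, if_true]
      exact Finset.inf'_le (fun x => x i) hx
    · simp only [m, hi, if_false]
      exact (hσΔ x hx).1 i
  have hm0 : ∀ i, 0 ≤ m i := by
    intro i
    by_cases hi : i ∈ C
    · simp only [m, hi, if_true]
      exact Finset.le_inf' _ _ fun x hx => (hσΔ x hx).1 i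
    · simp [m, hi]
  have hsum : ∀ x ∈ σ, ∑ i, (x i - m i) = 1 - ∑ i, m i := by
    intro x hx
    rw [Finset.sum_sub_distrib, (hσΔ x hx).2]
  set s := 1 - ∑ i, m i with hs
  have hs0 : 0 ≤ s := by
    rw [← hsum p₀ hp₀]
    exact Finset.sum_nonneg fun i _ => sub_nonneg.2 (hmle p₀ hp₀ i)
  have hCpos : (0 : ℝ) < C.card := by exact_mod_cast hC.card_pos
  -- distribute the missing mass `s` evenly over `C`
  have hsδ : s ≤ Fintype.card I * δ := by
    let z : I → ℝ := fun i => m i + if i ∈ C then s / C.card else 0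
    have hz : z ∈ stdSimplex ℝ I := by
      constructor
      · intro i
        have : 0 ≤ s / C.card := by positivity
        simp only [z]
        split_ifs
        · linarith [hm0 i]
        · linarith [hm0 i]
      · simp only [z, Finset.sum_add_distrib, Finset.sum_ite_mem, Finset.univ_inter,
          Finset.sum_const, nsmul_eq_mul]
        rw [mul_div_cancel₀ _ hCpos.ne', hs]
        ring
    obtain ⟨y, hyX, hy⟩ := hnet z hz
    obtain ⟨i, hiC, hi⟩ := hdom y hyX
    have h1 : y i ≤ m i := by
      simp only [m, hiC, if_true]
      exact Finset.le_inf' _ _ hi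
    have h2 : z i - y i < δ :=
      (le_abs_self _).trans_lt ((Real.dist_eq (z i) (y i) ▸ dist_le_pi_dist z y i).trans_lt hy)
    have h3 : s / C.card < δ := by
      simp only [z, hiC, if_true] at h2
      linarith
    have h4 : (C.card : ℝ) ≤ Fintype.card I := by exact_mod_cast C.card_le_univ
    calc s ≤ C.card * δ := by
          rw [div_lt_iff₀ hCpos] at h3
          linarith
      _ ≤ _ := by gcongr
  have hcoord : ∀ x ∈ σ, ∀ i, x i - m i ≤ s := by
    intro x hx i
    rw [← hsum x hx]
    exact Finset.single_le_sum (f := fun i => x i - m i)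
      (fun i _ => sub_nonneg.2 (hmle x hx i)) (Finset.mem_univ i)
  refine ⟨fun x hx p hp => (dist_pi_le_iff (hs0.trans hsδ)).2 fun i => ?_, fun p hp i hi => ?_⟩
  · rw [Real.dist_eq, abs_le]
    constructor <;> linarith [hcoord x hx i, hcoord p hp i, hmle x hx i, hmle p hp i]
  · have := hcoord p hp i
    simp only [m, hi, if_false] at this
    linarith

/-- **Sperner's covering lemma**: if closed sets `A i` cover a simplex and each `A i` contains the
face opposite to the vertex `i`, then they have a common point. -/
theorem stdSimplex.exists_mem_forall_mem {I : Type*} [Fintype I] [Nonempty I]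
    {A : I → Set (I → ℝ)} (hA : ∀ i, IsClosed (A i))
    (hcover : ∀ x ∈ stdSimplex ℝ I, ∃ i, x ∈ A i)
    (hface : ∀ i, ∀ x ∈ stdSimplex ℝ I, x i = 0 → x ∈ A i) :
    ∃ x ∈ stdSimplex ℝ I, ∀ i, x ∈ A i := by
  classical
  have happrox : ∀ ε : ℝ, 0 < ε → ∃ p ∈ stdSimplex ℝ I, ∀ i,
      p i ≤ ε ∨ ∃ x ∈ A i, dist x p ≤ ε := by
    intro ε hε
    have hI : (0 : ℝ) < Fintype.card I := by exact_mod_cast Fintype.card_pos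
    obtain ⟨T, hTsub, hTfin, hT⟩ := (isCompact_stdSimplex (𝕜 := ℝ) I).finite_cover_balls
      (div_pos hε hI)
    lift T to Finset (I → ℝ) using hTfin
    have hnet : ∀ z ∈ stdSimplex ℝ I, ∃ x ∈ T, dist z x < ε / Fintype.card I := by
      intro z hz
      simpa using hT hz
    have : Nonempty T := by
      obtain ⟨x, hx, -⟩ := hnet _ (single_mem_stdSimplex ℝ (Classical.arbitrary I))
      exact ⟨⟨x, hx⟩⟩
    choose c hc using fun x : T => hcover x (hTsub x.2)
    obtain ⟨σ, C, hσC, hdom⟩ := exists_colourful_dominant (fun i (x : T) => (x : I → ℝ) i) c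
    obtain ⟨i, hiC, -⟩ := hdom (Classical.arbitrary T)
    obtain ⟨p, hp, -⟩ := hσC i hiC
    have hmem : ∀ x ∈ σ, (x : I → ℝ) ∈ σ.map (Function.Embedding.subtype _) :=
      fun x hx => Finset.mem_map_of_mem _ hx
    obtain ⟨h1, h2⟩ := stdSimplex.small_of_dominant (σ := σ.map (Function.Embedding.subtype _))
      (fun x hx => hTsub hx) hnet
      (by intro x hx; obtain ⟨y, -, rfl⟩ := Finset.mem_map.1 hx; exact y.2) ⟨p, hmem p hp⟩
      ⟨i, hiC⟩ (by
        intro y hy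
        obtain ⟨j, hj, hj'⟩ := hdom ⟨y, hy⟩
        refine ⟨j, hj, fun x hx => ?_⟩
        obtain ⟨x, hx', rfl⟩ := Finset.mem_map.1 hx
        exact hj' x hx')
    rw [mul_div_cancel₀ _ hI.ne'] at h1 h2
    refine ⟨p, hTsub p.2, fun j => ?_⟩
    by_cases hj : j ∈ C
    · obtain ⟨x, hx, rfl⟩ := hσC j hj
      exact Or.inr ⟨x, hc x, h1 _ (hmem x hx) _ (hmem p hp)⟩
    · exact Or.inl (h2 _ (hmem p hp) j hj)
  choose p hpΔ hp using fun n : ℕ => happrox (1 / ((n : ℝ) + 1)) (by positivity)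
  obtain ⟨q, hq, φ, hφ, hlim⟩ := (isCompact_stdSimplex (𝕜 := ℝ) I).tendsto_subseq hpΔ
  have hε : Filter.Tendsto (fun n => 1 / ((φ n : ℝ) + 1)) Filter.atTop (nhds 0) :=
    tendsto_one_div_add_atTop_nhds_zero_nat.comp hφ.tendsto_atTop
  refine ⟨q, hq, fun i => ?_⟩
  by_contra hqi
  have hqi0 : 0 < q i := lt_of_le_of_ne (hq.1 i) fun h => hqi (hface i q hq h.symm)
  obtain ⟨η, hη, hball⟩ := Metric.isOpen_iff.1 (hA i).isOpen_compl q hqi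
  have e1 : ∀ᶠ n in Filter.atTop, dist (p (φ n)) q < η / 2 :=
    (Metric.tendsto_nhds.1 hlim) _ (half_pos hη)
  have e2 : ∀ᶠ n in Filter.atTop, 1 / ((φ n : ℝ) + 1) < η / 2 :=
    hε.eventually_lt_const (half_pos hη)
  have e3 : ∀ᶠ n in Filter.atTop, 1 / ((φ n : ℝ) + 1) < p (φ n) i :=
    hε.eventually_lt ((tendsto_pi_nhds.1 hlim) i) hqi0
  obtain ⟨n, h1, h2, h3⟩ := (e1.and (e2.and e3)).exists
  rcases hp (φ n) i with h | ⟨x, hx, hxp⟩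
  · exact absurd h3 (not_lt.2 h)
  · exact hball (Metric.mem_ball.2 ((dist_triangle x (p (φ n)) q).trans_lt (by linarith))) hx

/-- A continuous vector field `φ` on a simplex that is orthogonal to the position vector has a
point where all its components are non-positive. -/
theorem stdSimplex.exists_forall_nonpos {I : Type*} [Fintype I] [Nonempty I]
    {φ : stdSimplex ℝ I → I → ℝ} (hφ : Continuous φ)
    (horth : ∀ x : stdSimplex ℝ I, ∑ i, x.1 i * φ x i = 0) :
    ∃ x, ∀ i, φ x i ≤ 0 := by
  -- Nash's map `x ↦ (x + φ⁺) / (1 + ∑ φ⁺)` does not decrease the `i`-th coordinate where `0 ≤ ψ i`.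
  let ψ : I → stdSimplex ℝ I → ℝ := fun i x =>
    max (φ x i) 0 - x.1 i * ∑ j, max (φ x j) 0
  have hφi : ∀ i, Continuous fun x => φ x i := fun i => (continuous_apply i).comp hφ
  have hxi : ∀ i, Continuous fun x : stdSimplex ℝ I => x.1 i := fun i =>
    (continuous_apply i).comp continuous_subtype_val
  have hψ : ∀ i, Continuous (ψ i) := fun i =>
    ((hφi i).max continuous_const).sub
      ((hxi i).mul (continuous_finsetSum _ fun j _ => (hφi j).max continuous_const))
  have hψsum : ∀ x, ∑ i, ψ i x = 0 := by
    intro x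
    simp only [ψ, Finset.sum_sub_distrib, ← Finset.sum_mul, x.2.2, one_mul, sub_self]
  obtain ⟨x, -, hxψ⟩ := stdSimplex.exists_mem_forall_mem
    (A := fun i => Subtype.val '' {x | 0 ≤ ψ i x})
    (fun i => (isClosed_stdSimplex ℝ I).isClosedMap_subtype_val _
      (isClosed_le continuous_const (hψ i)))
    (fun x hx => by
      by_contra! hcon
      have hneg : ∀ i, ψ i ⟨x, hx⟩ < 0 := fun i =>
        not_le.1 fun h => hcon i ⟨⟨x, hx⟩, h, rfl⟩
      exact (Finset.sum_neg (fun i _ => hneg i) Finset.univ_nonempty).ne (hψsum ⟨x, hx⟩))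
    (fun i x hx hxi => ⟨⟨x, hx⟩, by simp [ψ, hxi], rfl⟩)
  obtain ⟨x, -, rfl⟩ := hxψ (Classical.arbitrary I)
  have hnonneg : ∀ i, 0 ≤ ψ i x := by
    intro i
    obtain ⟨x', hx', h⟩ := hxψ i
    exact Subtype.ext h ▸ hx'
  have hzero : ∀ i, ψ i x = 0 := fun i =>
    (Finset.sum_eq_zero_iff_of_nonneg fun i _ => hnonneg i).1 (hψsum x) i (Finset.mem_univ i)
  have hsq : ∑ i, max (φ x i) 0 ^ 2 = 0 := by
    calc ∑ i, max (φ x i) 0 ^ 2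
        = ∑ i, (x.1 i * φ x i) * ∑ j, max (φ x j) 0 := by
          refine Finset.sum_congr rfl fun i _ => ?_
          have h1 : max (φ x i) 0 = x.1 i * ∑ j, max (φ x j) 0 := sub_eq_zero.1 (hzero i)
          have h2 : max (φ x i) 0 ^ 2 = max (φ x i) 0 * φ x i := by
            rcases le_total (φ x i) 0 with h | h <;> simp [h, sq]
          rw [h2, h1]
          ring
      _ = 0 := by rw [← Finset.sum_mul, horth x, zero_mul]
  refine ⟨x, fun i => ?_⟩
  have := (Finset.sum_eq_zero_iff_of_nonneg fun i _ => sq_nonneg (max (φ x i) 0)).1 hsq i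
    (Finset.mem_univ i)
  exact max_eq_right_iff.1 ((pow_eq_zero_iff two_ne_zero).1 this)

/-! ### Variational inequalities on compact convex sets -/

section VariationalInequality

variable {L : Type*} [NormedAddCommGroup L] [InnerProductSpace ℝ L]

/-- **The Hartman–Stampacchia theorem**: every continuous vector field on a non-empty compact
convex set `K` is normal and directed exteriorly to `K` at some point of `K`. -/
theorem Convex.exists_isExteriorNormal {K : Set L} (hK : Convex ℝ K) (hKc : IsCompact K)
    (hKne : K.Nonempty) {S : K → L} (hS : Continuous S) :
    ∃ f : K, DefensiveForecasting.IsExteriorNormal K (f : L) (S f) := by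
  have : CompactSpace K := isCompact_iff_compactSpace.1 hKc
  have : Nonempty K := hKne.to_subtype
  -- By compactness it suffices to satisfy finitely many of the inequalities at a time.
  obtain ⟨f, -, hf⟩ := (isCompact_univ (X := K)).inter_iInter_nonempty
    (fun g : K => {f : K | inner ℝ (S f) ((g : L) - f) ≤ 0})
    (fun g => isClosed_le
      (hS.inner (continuous_const.sub continuous_subtype_val)) continuous_const) (by
      intro u
      rcases u.eq_empty_or_nonempty with rfl | hu
      · simp
      have : Nonempty u := hu.to_subtype
      let f : stdSimplex ℝ u → K := fun x =>
        ⟨∑ i, x.1 i • ((i : K) : L), hK.sum_mem (fun i _ => x.2.1 i) x.2.2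
          fun i _ => (i : K).2⟩
      have hf : Continuous f := by
        refine Continuous.subtype_mk (continuous_finsetSum _ fun i _ => ?_) _
        exact ((continuous_apply i).comp continuous_subtype_val).smul continuous_const
      obtain ⟨x, hx⟩ := stdSimplex.exists_forall_nonpos
        (φ := fun x (i : u) => inner ℝ (S (f x)) (((i : K) : L) - f x))
        (continuous_pi fun i =>
          (hS.comp hf).inner (continuous_const.sub (continuous_subtype_val.comp hf)))
        (fun x => by
          simp_rw [← real_inner_smul_right, ← inner_sum, smul_sub, Finset.sum_sub_distrib,
            ← Finset.sum_smul]
          rw [x.2.2, one_smul, sub_self, inner_zero_right])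
      exact ⟨f x, Set.mem_univ _, Set.mem_iInter₂.2 fun g hg => hx ⟨g, hg⟩⟩)
  exact ⟨f, fun g hg => Set.mem_iInter.1 hf ⟨g, hg⟩⟩

/-- A non-zero exterior normal can only sit at a boundary point. -/
theorem DefensiveForecasting.IsExteriorNormal.mem_frontier {K : Set L} {f v : L}
    (h : DefensiveForecasting.IsExteriorNormal K f v) (hf : f ∈ K) (hv : v ≠ 0) :
    f ∈ frontier K := by
  refine ⟨subset_closure hf, fun hint => hv ?_⟩
  have hc : ContinuousAt (fun t : ℝ => f + t • v) 0 := by fun_prop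
  have hK : ∀ᶠ t in nhdsWithin (0 : ℝ) (Set.Ioi 0), f + t • v ∈ K :=
    (hc.eventually (by simpa using mem_interior_iff_mem_nhds.1 hint)).filter_mono
      nhdsWithin_le_nhds
  obtain ⟨t, ht, ht0⟩ := (hK.and self_mem_nhdsWithin).exists
  have h1 := h _ ht
  rw [add_sub_cancel_left, real_inner_smul_right] at h1
  rw [real_inner_self_eq_norm_sq] at h1
  have h2 : ‖v‖ ^ 2 ≤ 0 := nonpos_of_mul_nonpos_right h1 ht0
  exact norm_eq_zero.1 (pow_eq_zero_iff two_ne_zero |>.1 (le_antisymm h2 (sq_nonneg _)))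

theorem isCompact_closedConvexHull [CompleteSpace L] {Y : Set L} (hY : IsCompact (closure Y)) :
    IsCompact (closedConvexHull ℝ Y) := by
  rw [closedConvexHull_eq_closure_convexHull]
  exact ((hY.totallyBounded.subset subset_closure).convexHull.closure).isCompact_of_isClosed
    isClosed_closure

theorem dist_le_diam_of_mem_closedConvexHull {Y : Set L} (hY : Bornology.IsBounded Y) {y f : L}
    (hy : y ∈ Y) (hf : f ∈ closedConvexHull ℝ Y) : dist y f ≤ Metric.diam Y := by
  have : closedConvexHull ℝ Y ⊆ Metric.closedBall y (Metric.diam Y) :=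
    closedConvexHull_min (fun z hz => Metric.dist_le_diam_of_mem hY hz hy)
      (convex_closedBall _ _) Metric.isClosed_closedBall
  rw [dist_comm]
  exact this hf

end VariationalInequality

/-! ### K29 strategies -/

namespace DefensiveForecasting

variable {X L H : Type*} [NormedAddCommGroup L] [InnerProductSpace ℝ L] {Y : Set L}

theorem exists_isK29Forecast [CompleteSpace L] (hY : Y.Nonempty) (hYc : IsCompact (closure Y))
    {k : ForecastSpace Y × X → ForecastSpace Y × X → ℝ} (hk : IsAdmissible k)
    (hsymm : ∀ z z', k z z' = k z' z) {n : ℕ} (h : History X Y n) (x : X) :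
    ∃ f, IsK29Forecast k h x f := by
  by_cases h0 : ∃ g, vectorField k h x g = 0
  · exact h0.imp fun g hg => Or.inl hg
  have hS : Continuous (vectorField k h x) := by
    refine continuous_finsetSum _ fun i _ => Continuous.smul ?_ continuous_const
    simp_rw [hsymm ((h i).2.1, (h i).1)]
    exact hk x _
  obtain ⟨f, hf⟩ := convex_closedConvexHull.exists_isExteriorNormal
    (isCompact_closedConvexHull hYc) (hY.mono subset_closedConvexHull) hS
  exact ⟨f, Or.inr ⟨h0, hf.mem_frontier f.2 fun hz => h0 ⟨f, hz⟩, hf⟩⟩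

theorem IsK29Forecast.inner_nonpos {k : ForecastSpace Y × X → ForecastSpace Y × X → ℝ} {n : ℕ}
    {h : History X Y n} {x : X} {f : ForecastSpace Y} (hf : IsK29Forecast k h x f) (y : Y) :
    inner ℝ (vectorField k h x f) ((y : L) - (f : L)) ≤ 0 := by
  rcases hf with h0 | ⟨-, -, hn⟩
  · simp [h0]
  · exact hn y (subset_closedConvexHull y.2)

open scoped TensorProduct

variable [NormedAddCommGroup H] [InnerProductSpace ℝ H] [CompleteSpace H]
  [RKHS ℝ H (ForecastSpace Y × X) ℝ]

variable (H) in
/-- The sum of the tensors `K_z ⊗ (y - f)` over the first `n` rounds; its inner product with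
`F ⊗ u` is that of `∑ i, F (fᵢ, xᵢ) • (yᵢ - fᵢ)` with `u`. -/
noncomputable def errorTensor (σ : Strategy X Y) (x : ℕ → X) (y : ℕ → Y) (n : ℕ) : H ⊗[ℝ] L :=
  ∑ i ∈ Finset.range n, representer H (forecasts σ x y i, x i) ⊗ₜ[ℝ]
    ((y i : L) - (forecasts σ x y i : L))

theorem inner_errorTensor (σ : Strategy X Y) (x : ℕ → X) (y : ℕ → Y) (n : ℕ) (F : H) (u : L) :
    inner ℝ (errorTensor H σ x y n) (F ⊗ₜ[ℝ] u) =
      inner ℝ (∑ i ∈ Finset.range n, F (forecasts σ x y i, x i) •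
        ((y i : L) - (forecasts σ x y i : L))) u := by
  simp only [errorTensor, sum_inner, TensorProduct.inner_tmul, inner_representer,
    real_inner_smul_left]

/-- The K29 rule keeps the cross term non-positive when a round is added to the error tensor, so
that the squared norm grows by at most `(diam Y * C) ^ 2` in each round. -/
theorem sq_norm_errorTensor_le (hY : Bornology.IsBounded Y)
    (hbdd : BddAbove (Set.range fun z : ForecastSpace Y × X => ‖representer H z‖))
    {σ : Strategy X Y} (hσ : IsK29Strategy (rkhsKernel H) σ) (x : ℕ → X) (y : ℕ → Y) (n : ℕ) :
    ‖errorTensor H σ x y n‖ ^ 2 ≤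
      n * (Metric.diam Y * rkhsConst (Z := ForecastSpace Y × X) H) ^ 2 := by
  induction n with
  | zero => simp [errorTensor]
  | succ n ih =>
    set z := (forecasts σ x y n, x n)
    set d := (y n : L) - (forecasts σ x y n : L) with hd
    have hstep : errorTensor H σ x y (n + 1) = errorTensor H σ x y n + representer H z ⊗ₜ[ℝ] d :=
      Finset.sum_range_succ _ _
    have hcross : inner ℝ (errorTensor H σ x y n) (representer H z ⊗ₜ[ℝ] d) ≤ 0 := by
      have h := (hσ n (fun i : Fin n => (x i, forecasts σ x y i, y i)) (x n)).inner_nonpos (y n)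
      have hf : forecasts σ x y n = σ n (fun i : Fin n => (x i, forecasts σ x y i, y i)) (x n) := by
        rw [forecasts]
      rw [← hf] at h
      convert h using 1
      simp only [errorTensor, sum_inner, TensorProduct.inner_tmul, vectorField,
        real_inner_smul_left, rkhsKernel]
      exact (Fin.sum_univ_eq_sum_range (fun i =>
        inner ℝ (representer H (forecasts σ x y i, x i)) (representer H z) *
          inner ℝ ((y i : L) - (forecasts σ x y i : L)) d) n).symm
    have hz : ‖representer H z‖ ≤ rkhsConst (Z := ForecastSpace Y × X) H := le_ciSup hbdd z
    have hd' : ‖d‖ ≤ Metric.diam Y := by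
      rw [hd, ← dist_eq_norm]
      exact dist_le_diam_of_mem_closedConvexHull hY (y n).2 (forecasts σ x y n).2
    have hprod : ‖representer H z ⊗ₜ[ℝ] d‖ ^ 2 ≤
        (Metric.diam Y * rkhsConst (Z := ForecastSpace Y × X) H) ^ 2 := by
      rw [TensorProduct.norm_tmul, mul_comm]
      gcongr
    rw [hstep, norm_add_sq_real]
    push_cast
    linarith

end DefensiveForecasting

theorem theorem4 {X L H : Type*}
    [NormedAddCommGroup L] [InnerProductSpace ℝ L] [CompleteSpace L]
    (Y : Set L) (hY : Y.Nonempty) (hYc : IsCompact (closure Y))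
    [NormedAddCommGroup H] [InnerProductSpace ℝ H] [CompleteSpace H]
    [RKHS ℝ H (DefensiveForecasting.ForecastSpace Y × X) ℝ]
    (hadm : DefensiveForecasting.IsAdmissible (DefensiveForecasting.rkhsKernel H))
    (hbdd : BddAbove (Set.range fun z : DefensiveForecasting.ForecastSpace Y × X =>
      ‖DefensiveForecasting.representer H z‖)) :
    (∃ σ : DefensiveForecasting.Strategy X Y,
      DefensiveForecasting.IsK29Strategy (DefensiveForecasting.rkhsKernel H) σ) ∧
    ∀ σ : DefensiveForecasting.Strategy X Y,
      DefensiveForecasting.IsK29Strategy (DefensiveForecasting.rkhsKernel H) σ →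
      ∀ (x : ℕ → X) (y : ℕ → Y) (n : ℕ) (F : H),
        ‖∑ i ∈ Finset.range n,
            F (DefensiveForecasting.forecasts σ x y i, x i) •
              ((y i : L) - (DefensiveForecasting.forecasts σ x y i : L))‖
          ≤ Metric.diam Y * DefensiveForecasting.rkhsConst H * ‖F‖ * √(n : ℝ) := by
  refine ⟨?_, fun σ hσ x y n F => ?_⟩
  · choose σ hσ using fun n (h : DefensiveForecasting.History X Y n) x =>
      DefensiveForecasting.exists_isK29Forecast hY hYc hadm
        (fun z z' => real_inner_comm (DefensiveForecasting.representer H z')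
          (DefensiveForecasting.representer H z)) h x
    exact ⟨σ, hσ⟩
  set u := ∑ i ∈ Finset.range n, F (DefensiveForecasting.forecasts σ x y i, x i) •
    ((y i : L) - (DefensiveForecasting.forecasts σ x y i : L)) with hu
  have hYb : Bornology.IsBounded Y := hYc.isBounded.subset subset_closure
  have hC : 0 ≤ DefensiveForecasting.rkhsConst (Z := DefensiveForecasting.ForecastSpace Y × X) H :=
    Real.iSup_nonneg fun _ => norm_nonneg _
  have hv : ‖DefensiveForecasting.errorTensor H σ x y n‖ ≤ √(n : ℝ) * (Metric.diam Y *
      DefensiveForecasting.rkhsConst (Z := DefensiveForecasting.ForecastSpace Y × X) H) := by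
    refine (sq_le_sq₀ (norm_nonneg _) (by positivity)).1 ?_
    rw [mul_pow, Real.sq_sqrt n.cast_nonneg]
    exact DefensiveForecasting.sq_norm_errorTensor_le hYb hbdd hσ x y n
  have huv : ‖u‖ * ‖u‖ ≤ ‖DefensiveForecasting.errorTensor H σ x y n‖ * ‖F‖ * ‖u‖ := by
    rw [← real_inner_self_eq_norm_mul_norm]
    nth_rewrite 1 [hu]
    rw [← DefensiveForecasting.inner_errorTensor σ x y n F u, mul_assoc,
      ← TensorProduct.norm_tmul (𝕜 := ℝ) F u]
    exact real_inner_le_norm (DefensiveForecasting.errorTensor H σ x y n)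
      (TensorProduct.tmul ℝ F u)
  have hle : ‖u‖ ≤ ‖DefensiveForecasting.errorTensor H σ x y n‖ * ‖F‖ := by
    rcases (norm_nonneg u).eq_or_lt with h0 | h0
    · rw [← h0]
      positivity
    · exact le_of_mul_le_mul_right huv h0
  calc ‖u‖ ≤ _ := hle
    _ ≤ √(n : ℝ) * (Metric.diam Y * DefensiveForecasting.rkhsConst
          (Z := DefensiveForecasting.ForecastSpace Y × X) H) * ‖F‖ := by gcongr
    _ = _ := by ring
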